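/- Let $K$ be a field with $\operatorname{char} K \neq 2$, let $D \in K^\times$, and let $G_K = \operatorname{Gal}(K^{\mathrm{sep}}/K)$. For a commutative ring $R$ and $d\in R$ write $R[\sqrt d] = R[X]/(X^2-d)$ (for $R=K$, $d$ is allowed to be a square). Let $M$ be the group $\mathbb{Z}/4$ on which $g \in G_K$ acts as the identity if $g$ fixes the two $K$-algebra maps $K[\sqrt D]\to K^{\mathrm{sep}}$, and as $-1$ if $g$ swaps them. Let $H^1(K,M)$ be the group of continuous crossed homomorphisms $\sigma : G_K \to M$ modulo the maps $g \mapsto gx - x$ $(x\in M)$, and let $N : K[\sqrt{-D}] \to K$ be the norm, $N(a+b\sqrt{-D}) = a^2 + Db^2$. Then there is a group isomorphism $$H^1(K,M) \;\cong\; \{(\alpha,c) \in K[\sqrt{-D}]^\times \times K^\times : N(\alpha) = c^4\} \,/\, \{(\beta^4, N(\beta)) : \beta \in K[\sqrt{-D}]^\times\}$$ with the following property. Whenever the class of a cocycle $\sigma$ corresponds to the class of a pair $(a + b\sqrt{-D}, c)$ with $a,b,c\in K$ and $b \neq 0$, the quartic algebra corresponding to $\sigma$ is $$L = K\left[\sqrt{2a+2c^2}\right]\left[\sqrt{2c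 + \sqrt{2a+2c^2}}\right].$$ That is, $L$ is étale over $K$, and its $K$-algebra maps to $K^{\mathrm{sep}}$ can be labelled bijectively as $(\iota_x)_{x \in M}$ such that $g \circ \iota_x = \iota_{gx + \sigma(g)}$ for all $g \in G_K$ and $x\in M$, and such that $\iota_x$ and $\iota_y$ agree on the subalgebra $K[\sqrt{2a+2c^2}]$ if and only if $2x = 2y$ (so the labelling respects the $D_4$-structure that $L$ has as a quadratic extension of a quadratic extension). Moreover, if $K$ has more than $5$ elements, then every class in the quotient group on the right is represented by a pair $(a + b\sqrt{-D}, c)$ with $b \neq 0$. -/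

import Mathlib

/-! ### First continuous cohomology of a discrete Galois module -/

/-- The absolute Galois group `G_K = Gal(K^sep / K)`, with its Krull topology. -/
abbrev AbsGal (K : Type*) [Field K] : Type _ :=
  SeparableClosure K ≃ₐ[K] SeparableClosure K

/-- Continuous 1-cocycles `σ : G → M` (crossed homomorphisms). The module `M` is discrete, so
continuity is local constancy. -/
def Z1 (G M : Type*) [Group G] [TopologicalSpace G] [AddCommGroup M] [DistribMulAction G M] :
    AddSubgroup (G → M) where
  carrier := {σ | IsLocallyConstant σ ∧ ∀ g h : G, σ (g * h) = σ g + g • σ h}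
  zero_mem' := ⟨IsLocallyConstant.const 0, fun g h => by simp⟩
  add_mem' := by
    rintro σ τ ⟨hσ, hσ'⟩ ⟨hτ, hτ'⟩
    refine ⟨hσ.add hτ, fun g h => ?_⟩
    simp only [Pi.add_apply, hσ', hτ', smul_add]
    abel
  neg_mem' := by
    rintro σ ⟨hσ, hσ'⟩
    refine ⟨hσ.neg, fun g h => ?_⟩
    simp only [Pi.neg_apply, hσ', smul_neg]
    abel

/-- 1-coboundaries `g ↦ g x - x`. -/
def B1 (G M : Type*) [Group G] [AddCommGroup M] [DistribMulAction G M] :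
    AddSubgroup (G → M) where
  carrier := {σ | ∃ x : M, ∀ g : G, σ g = g • x - x}
  zero_mem' := ⟨0, fun g => by simp⟩
  add_mem' := by
    rintro σ τ ⟨x, hx⟩ ⟨y, hy⟩
    refine ⟨x + y, fun g => ?_⟩
    simp only [Pi.add_apply, hx, hy, smul_add]
    abel
  neg_mem' := by
    rintro σ ⟨x, hx⟩
    refine ⟨-x, fun g => ?_⟩
    simp only [Pi.neg_apply, hx, smul_neg]
    abel

/-- `H¹(G, M) = Z¹(G, M) / B¹(G, M)`. -/
abbrev H1 (G M : Type*) [Group G] [TopologicalSpace G] [AddCommGroup M] [DistribMulAction G M] :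
    Type _ :=
  Z1 G M ⧸ (B1 G M).addSubgroupOf (Z1 G M)

/-! ### Quadratic algebras and the associated cyclic module of order four -/

/-- The quadratic algebra `R[√d] = R[X] / (X² - d)`; the element `⟨x, y⟩` is `x + y √d`. -/
abbrev SqrtAlg {R : Type*} [CommRing R] (d : R) : Type _ := QuadraticAlgebra R d 0

/-- The coordinates of a `K`-algebra `L`: its `K`-algebra maps to `K^sep`. -/
abbrev Coord (K L : Type*) [Field K] [CommRing L] [Algebra K L] : Type _ :=
  L →ₐ[K] SeparableClosure K

/-- `g` fixes each of the coordinates of `K[√D]`; otherwise it swaps the two of them. -/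
def FixesCoords {K : Type*} [Field K] (D : K) (g : AbsGal K) : Prop :=
  ∀ (ι : Coord K (SqrtAlg D)) (z : SqrtAlg D), g (ι z) = ι z

/-- The underlying group `ℤ/4` of the cyclic Galois module of order four attached to `K[√D]`. -/
def CyclicFour {K : Type*} [Field K] (_D : K) : Type := ZMod 4

instance {K : Type*} [Field K] (D : K) : AddCommGroup (CyclicFour D) :=
  inferInstanceAs (AddCommGroup (ZMod 4))

open Classical in
/-- The sign by which `g` acts: `1` if `g` fixes the two coordinates of `K[√D]`, and `-1` if it
swaps them. -/
noncomputable def quadSign {K : Type*} [Field K] (D : K) (g : AbsGal K) : ℤ :=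
  if FixesCoords D g then 1 else -1

theorem fixesCoords_iff {K : Type*} [Field K] (D : K) (g : AbsGal K) :
    FixesCoords D g ↔
      ∀ ι : Coord K (SqrtAlg D), g (ι QuadraticAlgebra.omega) = ι QuadraticAlgebra.omega := by
  refine ⟨fun h ι => h ι _, fun h ι z => ?_⟩
  have := QuadraticAlgebra.algHom_ext (f := (g : SeparableClosure K →ₐ[K] _).comp ι) (g := ι)
    (by simpa using h ι)
  exact DFunLike.congr_fun this z

theorem coord_omega_sq {K : Type*} [Field K] (D : K) (ι : Coord K (SqrtAlg D)) :
    ι QuadraticAlgebra.omega ^ 2 = algebraMap K (SeparableClosure K) D := by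
  rw [← map_pow, ← AlgHom.commutes ι]
  congr 1
  ext <;> simp [pow_two]

theorem quadSign_mul {K : Type*} [Field K] (D : K) (g h : AbsGal K) :
    quadSign D (g * h) = quadSign D g * quadSign D h := by
  have key : ∀ (k : AbsGal K) (ι ι' : Coord K (SqrtAlg D)),
      k (ι QuadraticAlgebra.omega) = ι QuadraticAlgebra.omega →
      k (ι' QuadraticAlgebra.omega) = ι' QuadraticAlgebra.omega := by
    intro k ι ι' hk
    rcases sq_eq_sq_iff_eq_or_eq_neg.mp
      ((coord_omega_sq D ι').trans (coord_omega_sq D ι).symm) with e | e <;> simp [e, hk]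
  have neg : ∀ (k : AbsGal K) (ι : Coord K (SqrtAlg D)), ¬ FixesCoords D k →
      k (ι QuadraticAlgebra.omega) = - ι QuadraticAlgebra.omega := by
    intro k ι hk
    have e : (k (ι QuadraticAlgebra.omega)) ^ 2 = (ι QuadraticAlgebra.omega) ^ 2 := by
      rw [← map_pow, coord_omega_sq, AlgEquiv.commutes]
    rcases sq_eq_sq_iff_eq_or_eq_neg.mp e with e | e
    · exact absurd ((fixesCoords_iff D k).2 fun ι' => key k ι ι' e) hk
    · exact e
  have e : FixesCoords D (g * h) ↔ (FixesCoords D g ↔ FixesCoords D h) := by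
    by_cases hg : FixesCoords D g <;> by_cases hh : FixesCoords D h
    · simp only [hg, hh, iff_self, iff_true]
      intro ι z
      rw [AlgEquiv.mul_apply, hh, hg]
    · simp only [hg, hh, iff_false, not_true]
      intro H
      refine hh fun ι z => g.injective ?_
      rw [hg]
      exact H ι z
    · simp only [hg, hh, iff_true]
      refine iff_of_false (fun H => hg fun ι z => ?_) not_false
      have := H ι z
      rwa [AlgEquiv.mul_apply, hh] at this
    · simp only [hg, hh, iff_true]
      refine (fixesCoords_iff D _).2 fun ι => ?_
      rw [AlgEquiv.mul_apply, neg h ι hh, map_neg, neg g ι hg, neg_neg]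
  by_cases hg : FixesCoords D g <;> by_cases hh : FixesCoords D h <;> simp [quadSign, e, hg, hh]

/-- `G_K` acts on `ℤ/4` by automorphisms, permuting the two generators `1, -1` in the way it
permutes the two coordinates of `K[√D]`. -/
noncomputable instance {K : Type*} [Field K] (D : K) :
    DistribMulAction (AbsGal K) (CyclicFour D) where
  smul g x := quadSign D g • x
  one_smul x := by
    change quadSign D 1 • x = x
    have : FixesCoords D (1 : AbsGal K) := fun ι z => rfl
    simp [quadSign, this]
  mul_smul g h x := by
    change quadSign D (g * h) • x = quadSign D g • quadSign D h • x
    rw [quadSign_mul, mul_smul]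
  smul_zero g := smul_zero (quadSign D g)
  smul_add g := smul_add (quadSign D g)

/-! ### The group of Kummer data -/

/-- Pairs `(α, c)` in `K[√(-D)]ˣ × Kˣ` with `N(α) = c⁴`. -/
def kummerData {K : Type*} [Field K] (D : K) : Subgroup ((SqrtAlg (-D))ˣ × Kˣ) where
  carrier := {p | Units.map QuadraticAlgebra.norm p.1 = p.2 ^ 4}
  one_mem' := by simp
  mul_mem' := by
    intro p q hp hq
    simp only [Set.mem_ofPred_eq, Prod.fst_mul, Prod.snd_mul, map_mul, mul_pow] at *
    rw [hp, hq]
  inv_mem' := by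
    intro p hp
    simp only [Set.mem_ofPred_eq, Prod.fst_inv, Prod.snd_inv, map_inv, inv_pow] at *
    rw [hp]

/-- The pairs `(β⁴, N(β))` for `β` in `K[√(-D)]ˣ`. -/
def kummerTrivial {K : Type*} [Field K] (D : K) : Subgroup ((SqrtAlg (-D))ˣ × Kˣ) :=
  ((powMonoidHom 4).prod (Units.map QuadraticAlgebra.norm)).range

/-- `{(α, c) : N(α) = c⁴} / {(β⁴, N(β))}`. -/
abbrev KummerGroup {K : Type*} [Field K] (D : K) : Type _ :=
  kummerData D ⧸ (kummerTrivial D).subgroupOf (kummerData D)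

/-! ### Quartic algebras -/

/-- The algebra `K[√d, √(u + v√d)]`, a quadratic extension of the quadratic extension `K[√d]`. -/
abbrev BiquadAlg {K : Type*} [Field K] (d u v : K) : Type _ :=
  SqrtAlg (R := SqrtAlg d) ⟨u, v⟩

/-- The étale algebra `K[√d, √(u + v√d)]`, with its structure of quadratic extension of `K[√d]`,
corresponds to the cocycle `σ` with values in the module `M = ℤ/4` attached to `K[√D]`: its
coordinates `ι_x` can be labelled by `x ∈ M` such that `g ∘ ι_x = ι_{g x + σ(g)}` for all
`g ∈ G_K`, and such that `ι_x` and `ι_y` agree on `K[√d]` exactly when `x` and `y` are equal or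
opposite vertices of the square `M` (that is, `2 x = 2 y`). -/
def CorrespondsTo {K : Type*} [Field K] (D : K) (σ : AbsGal K → CyclicFour D) (d u v : K) :
    Prop :=
  Algebra.Etale K (BiquadAlg d u v) ∧
  ∃ ι : CyclicFour D ≃ Coord K (BiquadAlg d u v),
    (∀ (g : AbsGal K) (x : CyclicFour D) (z : BiquadAlg d u v),
      g (ι x z) = ι (g • x + σ g) z) ∧
    (∀ x y : CyclicFour D, 2 • x = 2 • y ↔
      ∀ z : SqrtAlg d, ι x (algebraMap (SqrtAlg d) (BiquadAlg d u v) z) =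
        ι y (algebraMap (SqrtAlg d) (BiquadAlg d u v) z))

/-!
Put `Ω = K^sep`. On the units of `Ω[√(-D)]` consider the map `β ↦ (β⁴, N(β))`. Its image is the
group of pairs `(α, c)` with `N(α) = c⁴`, and its kernel is cyclic of order four, generated by
`√(-D)/√D` with `√D` in `Ω`, a square root of `-1` on which Galois acts by the sign with which it
acts on `√D`: the kernel is `M`. By Hilbert's Theorem 90 the first cohomology of the units of
`Ω[√(-D)]` vanishes, so Kummer theory gives the isomorphism: a class `(α, c)` corresponds to the
cocycle `g ↦ g(β)/β` of any preimage `β`.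

The traces `r_x` from `Ω[√(-D)]` to `Ω` of the translates `x β`, `x ∈ M`, are permuted by Galois
as `x ↦ g x + σ(g)`. From `tr(z)² = tr(z²) + 2 N(z)`, applied twice, `(r_x² - 2c)² = 2a + 2c²`,
so the `r_x` are the four roots of the quartic defining `L`, and `r_x² - 2c` depends only on `2x`.
They are distinct when `b ≠ 0`, because `(c² + a)(c² - a) = D b²`.
-/

open QuadraticAlgebra

/-! ### Quadratic algebras over a Galois extension -/

/-- The quadratic algebra `Ω[√d]` for `d` in the base field `K`. When `d` is a square in `Ω` it
splits, and `Gal(Ω/K)` acts on it through its action on the coefficients. -/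
abbrev ExtSqrtAlg {K : Type*} [Field K] (Ω : Type*) [Field Ω] [Algebra K Ω] (d : K) : Type _ :=
  SqrtAlg (algebraMap K Ω d)

namespace ExtSqrtAlg

variable {K Ω : Type*} [Field K] [Field Ω] [Algebra K Ω] {d : K}

instance : MulSemiringAction Gal(Ω/K) (ExtSqrtAlg Ω d) where
  smul_one g := by ext <;> simp
  smul_mul g z w := by ext <;> simp

theorem norm_smul (g : Gal(Ω/K)) (z : ExtSqrtAlg Ω d) : norm (g • z) = g (norm z) := by
  simp [norm_def]

theorem trace_smul (g : Gal(Ω/K)) (z : ExtSqrtAlg Ω d) : trace (g • z) = g (trace z) := by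
  simp [trace_def, map_ofNat]

variable (Ω) in
/-- The inclusion of `K[√d]` in `Ω[√d]`. -/
def ofBase : SqrtAlg d →+* ExtSqrtAlg Ω d where
  toFun z := ⟨algebraMap K Ω z.re, algebraMap K Ω z.im⟩
  map_one' := by ext <;> simp
  map_mul' z w := by ext <;> simp
  map_zero' := by ext <;> simp
  map_add' z w := by ext <;> simp

@[simp]
theorem re_ofBase (z : SqrtAlg d) : (ofBase Ω z).re = algebraMap K Ω z.re := rfl

@[simp]
theorem im_ofBase (z : SqrtAlg d) : (ofBase Ω z).im = algebraMap K Ω z.im := rfl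

theorem ofBase_injective : Function.Injective (ofBase Ω : SqrtAlg d →+* _) := fun z w h => by
  ext
  · exact (algebraMap K Ω).injective (congrArg re h)
  · exact (algebraMap K Ω).injective (congrArg im h)

theorem norm_ofBase (z : SqrtAlg d) : norm (ofBase Ω z) = algebraMap K Ω (norm z) := by
  simp [norm_def]

theorem trace_ofBase (z : SqrtAlg d) : trace (ofBase Ω z) = algebraMap K Ω (trace z) := by
  simp [trace_def, map_ofNat]

theorem smul_ofBase (g : Gal(Ω/K)) (z : SqrtAlg d) : g • ofBase Ω z = ofBase Ω z := by
  ext <;> simp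

theorem mem_range_ofBase [IsGalois K Ω] {z : ExtSqrtAlg Ω d} :
    z ∈ (ofBase Ω).range ↔ ∀ g : Gal(Ω/K), g • z = z := by
  refine ⟨?_, fun h => ?_⟩
  · rintro ⟨w, rfl⟩ g
    exact smul_ofBase g w
  · obtain ⟨x, hx⟩ := (InfiniteGalois.mem_range_algebraMap_iff_fixed (k := K) z.re).2
      fun g => congrArg re (h g)
    obtain ⟨y, hy⟩ := (InfiniteGalois.mem_range_algebraMap_iff_fixed (k := K) z.im).2
      fun g => congrArg im (h g)
    exact ⟨⟨x, y⟩, QuadraticAlgebra.ext hx hy⟩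

end ExtSqrtAlg

open ExtSqrtAlg

theorem norm_eq_mul_of_sq_eq {R : Type*} [CommRing R] {d ε : R} (hε : ε ^ 2 = d)
    (z : SqrtAlg d) :
    norm z = (z.re + ε * z.im) * (z.re - ε * z.im) := by
  rw [norm_def]
  linear_combination z.im * z.im * hε

/-- The splitting `F[√d] ≃ F × F` given by a nonzero square root `ε` of `d`: the two factors are
the values of `x + y√d` at `√d = ε` and at `√d = -ε`. -/
def splitEquiv {F : Type*} [Field F] [NeZero (2 : F)] {d ε : F} (hε : ε ^ 2 = d) (hε0 : ε ≠ 0) :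
    SqrtAlg d ≃+* F × F where
  toFun z := (z.re + ε * z.im, z.re - ε * z.im)
  invFun p := ⟨(p.1 + p.2) / 2, (p.1 - p.2) / (2 * ε)⟩
  left_inv z := by
    have h2 : (2 : F) ≠ 0 := two_ne_zero
    ext
    · field_simp
      ring
    · field_simp
      ring
  right_inv p := by
    have h2 : (2 : F) ≠ 0 := two_ne_zero
    ext
    · field_simp
      ring
    · field_simp
      ring
  map_mul' z w := by
    ext
    · simp only [re_mul, im_mul, Prod.fst_mul]
      linear_combination -z.im * w.im * hε
    · simp only [re_mul, im_mul, Prod.snd_mul]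
      linear_combination -z.im * w.im * hε
  map_add' z w := by
    ext
    · simp only [re_add, im_add, Prod.fst_add]
      ring
    · simp only [re_add, im_add, Prod.snd_add]
      ring

/-! ### The module `ℤ/4` as a group of units -/

section QuadSign

variable {K : Type*} [Field K] {D : K}

theorem quadSign_eq_one_or_neg_one (D : K) (g : AbsGal K) :
    quadSign D g = 1 ∨ quadSign D g = -1 := by
  unfold quadSign
  split_ifs <;> simp

theorem map_sqrt_eq_quadSign_smul {δ : SeparableClosure K}
    (hδ : δ ^ 2 = algebraMap K (SeparableClosure K) D) (g : AbsGal K) :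
    g δ = quadSign D g • δ := by
  unfold quadSign
  split_ifs with hg
  · let ι : Coord K (SqrtAlg D) :=
      lift ⟨δ, by rw [← pow_two, hδ, zero_smul, add_zero, Algebra.algebraMap_eq_smul_one]⟩
    have hι : ι ω = δ := by simp [ι]
    simpa only [hι, one_smul] using hg ι ω
  · have hsq : g δ ^ 2 = δ ^ 2 := by rw [← map_pow, hδ, AlgEquiv.commutes]
    rcases sq_eq_sq_iff_eq_or_eq_neg.1 hsq with hfix | hneg
    · refine absurd ((fixesCoords_iff D g).2 fun ι => ?_) hg
      rcases sq_eq_sq_iff_eq_or_eq_neg.1 ((coord_omega_sq D ι).trans hδ.symm) with h | h <;>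
        simp [h, hfix]
    · simpa using hneg

end QuadSign

namespace CyclicFour

variable {K : Type*} [Field K] {D : K}

theorem smul_eq_quadSign_smul (g : AbsGal K) (x : CyclicFour D) : g • x = quadSign D g • x := rfl

theorem four_nsmul (x : CyclicFour D) : 4 • x = 0 := by
  have h : ∀ x : ZMod 4, 4 • x = 0 := by decide
  exact h x

theorem nsmul_two_eq_iff {m : CyclicFour D} (hm : m ≠ 0) (hm2 : 2 • m = 0) {x y : CyclicFour D} :
    2 • x = 2 • y ↔ x = y ∨ x = y + m := by
  have h : ∀ m x y : ZMod 4, m ≠ 0 → 2 • m = 0 → (2 • x = 2 • y ↔ x = y ∨ x = y + m) := by decide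
  exact h m x y hm hm2

end CyclicFour

section KummerChar

variable {K : Type*} [Field K] {D : K}

/-- `χ` identifies the Galois module `M = ℤ/4` with the kernel of the map `β ↦ (β⁴, N(β))` on
the units of `K^sep[√(-D)]`. -/
structure IsKummerChar (χ : AddChar (CyclicFour D) (ExtSqrtAlg (SeparableClosure K) (-D))) :
    Prop where
  injective : Function.Injective χ
  smul_apply (g : AbsGal K) (x : CyclicFour D) : g • χ x = χ (g • x)
  norm_apply (x : CyclicFour D) : norm (χ x) = 1
  exists_eq {z : ExtSqrtAlg (SeparableClosure K) (-D)} (hz : z ^ 4 = 1) (hz' : norm z = 1) :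
    ∃ x, χ x = z

section Roots

variable {F : Type*} [Field F] {d : F} [NeZero (2 : F)]

theorem four_ne_zero_of_two_ne_zero : (4 : F) ≠ 0 := by
  simpa [show (4 : F) = 2 * 2 by norm_num] using two_ne_zero (α := F)

theorem re_eq_zero_or_im_eq_zero_of_pow_four_eq_one {z : SqrtAlg d} (hz : z ^ 4 = 1)
    (hz' : norm z = 1) : z.re = 0 ∨ z.im = 0 := by
  have hstar : z * star z = 1 := by rw [← algebraMap_norm_eq_mul_star, hz', map_one]
  have him : (z ^ 2).im = (star z ^ 2).im :=
    congrArg im (by linear_combination (star z) ^ 2 * hz - (z * star z + 1) * z ^ 2 * hstar)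
  simp only [pow_two, im_mul, re_star, im_star, zero_mul, add_zero] at him
  have h : 4 * (z.re * z.im) = 0 := by linear_combination him
  simpa [four_ne_zero_of_two_ne_zero (F := F)] using h

theorem isPrimitiveRoot_of_sq_eq_neg_one {j : SqrtAlg d} (hj : j ^ 2 = -1) :
    IsPrimitiveRoot j 4 := by
  have hj1 : ¬j ^ 2 ^ 1 = 1 := by
    intro h
    have hre : (-1 : F) = 1 := congrArg re (hj.symm.trans (pow_one 2 ▸ h))
    exact two_ne_zero (α := F) (by linear_combination -hre)
  have hj4 : j ^ 2 ^ (1 + 1) = 1 := by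
    linear_combination (j ^ 2 - 1) * hj
  have hord : orderOf j = 4 := orderOf_eq_prime_pow hj1 hj4
  exact hord ▸ IsPrimitiveRoot.orderOf j

theorem eq_pow_of_pow_four_eq_one {j z : SqrtAlg d} (hj : j ^ 2 = -1) (hjre : j.re = 0)
    (hz : z ^ 4 = 1) (hz' : norm z = 1) : ∃ n < 4, z = j ^ n := by
  suffices h : z = 1 ∨ z = -1 ∨ z = j ∨ z = -j by
    rcases h with rfl | rfl | rfl | rfl
    · exact ⟨0, by simp⟩
    · exact ⟨2, by simp [hj]⟩
    · exact ⟨1, by simp⟩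
    · exact ⟨3, by simp [pow_succ j 2, hj]⟩
  have hjim : d * j.im ^ 2 = -1 := by simpa [pow_two, hjre, ← mul_assoc] using congrArg re hj
  rw [norm_def] at hz'
  rcases re_eq_zero_or_im_eq_zero_of_pow_four_eq_one hz (by rwa [norm_def]) with h | h
  · have hd : d ≠ 0 := by rintro rfl; simp at hjim
    have him : z.im ^ 2 = j.im ^ 2 :=
      mul_left_cancel₀ hd (by linear_combination -hz' - hjim + z.re * h)
    rcases sq_eq_sq_iff_eq_or_eq_neg.1 him with him | him
    · exact .inr (.inr (.inl (QuadraticAlgebra.ext (h.trans hjre.symm) him)))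
    · exact .inr (.inr (.inr (QuadraticAlgebra.ext (by simp [h, hjre]) (by simp [him]))))
  · have hre : z.re ^ 2 = 1 := by linear_combination hz' + d * z.im * h
    rcases sq_eq_sq_iff_eq_or_eq_neg.1 (hre.trans (one_pow 2).symm) with hre | hre
    · exact .inl (QuadraticAlgebra.ext hre h)
    · exact .inr (.inl (QuadraticAlgebra.ext (by simp [hre]) (by simp [h])))

end Roots

instance [NeZero (2 : K)] : NeZero (2 : SeparableClosure K) :=
  ⟨map_ofNat (algebraMap K (SeparableClosure K)) 2 ▸ (map_ne_zero _).2 two_ne_zero⟩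

theorem exists_sq_eq_algebraMap [NeZero (2 : K)] (d : K) :
    ∃ δ : SeparableClosure K, δ ^ 2 = algebraMap K _ d :=
  have : NeZero ((2 : ℕ) : SeparableClosure K) := ⟨by simpa using two_ne_zero⟩
  IsSepClosed.exists_pow_nat_eq _ 2

theorem exists_isKummerChar [NeZero (2 : K)] (hD : D ≠ 0) :
    ∃ χ : AddChar (CyclicFour D) (ExtSqrtAlg (SeparableClosure K) (-D)), IsKummerChar χ := by
  obtain ⟨δ, hδ⟩ := exists_sq_eq_algebraMap D
  have hδ0 : δ ≠ 0 := by rintro rfl; exact hD (by simpa using hδ.symm)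
  let j : ExtSqrtAlg (SeparableClosure K) (-D) := ⟨0, δ⁻¹⟩
  have hj : j ^ 2 = -1 := by
    ext
    · simp [j, pow_two, ← hδ, hδ0]
    · simp [j, pow_two]
  have hjnorm : norm j = 1 := by simp [j, norm_def, ← hδ, pow_two, hδ0]
  have hprim := isPrimitiveRoot_of_sq_eq_neg_one hj
  let χ : AddChar (CyclicFour D) (ExtSqrtAlg (SeparableClosure K) (-D)) :=
    AddChar.zmodChar 4 hprim.pow_eq_one
  have hχ (x : CyclicFour D) : χ x = j ^ ZMod.val (n := 4) x := AddChar.zmodChar_apply _ x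
  refine ⟨χ, fun x y h => ?_, fun g x => ?_, fun x => ?_, fun {z} hz hz' => ?_⟩
  · exact ZMod.val_injective 4 (hprim.pow_inj (ZMod.val_lt _) (ZMod.val_lt _) (by rwa [← hχ, ← hχ]))
  · have hδg := map_sqrt_eq_quadSign_smul hδ g
    rw [CyclicFour.smul_eq_quadSign_smul, hχ x, smul_pow']
    rcases quadSign_eq_one_or_neg_one D g with hg | hg
    · have hgj : g • j = j := by ext <;> simp [j, hδg, hg]
      rw [hgj, hg, one_smul, hχ]
    · have hgj : g • j = -j := by ext <;> simp [j, hδg, hg, inv_neg]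
      have hinv : (-j) ^ ZMod.val (n := 4) x * χ x = 1 := by
        rw [hχ, ← mul_pow, neg_mul, ← pow_two, hj, neg_neg, one_pow]
      rw [hgj, hg, neg_one_smul]
      exact left_inv_eq_right_inv hinv
        (by rw [← χ.map_add_eq_mul, add_neg_cancel, χ.map_zero_eq_one])
  · rw [hχ, map_pow, hjnorm, one_pow]
  · obtain ⟨n, hn, rfl⟩ := eq_pow_of_pow_four_eq_one hj rfl hz hz'
    exact ⟨(n : ZMod 4), (hχ _).trans (congrArg (j ^ ·) (ZMod.val_cast_of_lt hn))⟩

end KummerChar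

/-! ### Hilbert's Theorem 90 -/

section Hilbert90

theorem exists_apply_ne_zero_and_apply_ne_zero {A B C : Type*} [AddZeroClass A]
    [AddZeroClass B] [AddZeroClass C] {f : A →+ B} {g : A →+ C} (hf : f ≠ 0) (hg : g ≠ 0) :
    ∃ a, f a ≠ 0 ∧ g a ≠ 0 := by
  obtain ⟨a, ha⟩ := DFunLike.ne_iff.1 hf
  obtain ⟨b, hb⟩ := DFunLike.ne_iff.1 hg
  by_cases ha' : g a = 0
  · by_cases hb' : f b = 0
    · exact ⟨a + b, by simpa [hb'] using ha, by simpa [ha'] using hb⟩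
    · exact ⟨b, hb', hb⟩
  · exact ⟨a, ha, ha'⟩

variable {K Ω : Type*} [Field K] [Field Ω] [Algebra K Ω]

section Embeddings

variable {F : Type*} [Field F] [Algebra K F] [FiniteDimensional K F]

theorem sum_smul_toLinearMap_ne_zero {a : (F →ₐ[K] Ω) → Ω} (ha : a ≠ 0) :
    ∑ φ, a φ • (φ.toLinearMap : F →ₗ[K] Ω) ≠ 0 := fun h =>
  ha <| funext <| Fintype.linearIndependent_iff.1 (linearIndependent_algHom_toLinearMap K F Ω) a h

theorem exists_apply_sum_smul_ne_zero {V : Type*} [AddCommGroup V] [Module Ω V] {ℓ ℓ' : V →ₗ[Ω] Ω}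
    {s : (F →ₐ[K] Ω) → V} {φ₀ : F →ₐ[K] Ω} (h : ℓ (s φ₀) ≠ 0) (h' : ℓ' (s φ₀) ≠ 0) :
    ∃ x : F, ℓ (∑ φ, φ x • s φ) ≠ 0 ∧ ℓ' (∑ φ, φ x • s φ) ≠ 0 := by
  have hne {ℓ : V →ₗ[Ω] Ω} (h : ℓ (s φ₀) ≠ 0) :
      (∑ φ, ℓ (s φ) • φ.toLinearMap : F →ₗ[K] Ω).toAddMonoidHom ≠ 0 := fun h0 =>
    sum_smul_toLinearMap_ne_zero (fun hs => h (congrFun hs φ₀))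
      (LinearMap.toAddMonoidHom_injective h0)
  simpa [mul_comm] using exists_apply_ne_zero_and_apply_ne_zero (hne h) (hne h')

theorem exists_isUnit_sum_smul [Nonempty (F →ₐ[K] Ω)] {d : K} {ε : Ω}
    (hε : ε ^ 2 = algebraMap K Ω d) {s : (F →ₐ[K] Ω) → ExtSqrtAlg Ω d} (hs : ∀ φ, IsUnit (s φ)) :
    ∃ x : F, IsUnit (∑ φ, φ x • s φ) := by
  let value (η : Ω) : ExtSqrtAlg Ω d →ₗ[Ω] Ω := reₗ _ _ + η • imₗ _ _
  have hunit (z : ExtSqrtAlg Ω d) : IsUnit z ↔ value ε z ≠ 0 ∧ value (-ε) z ≠ 0 := by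
    rw [isUnit_iff_norm_isUnit, norm_eq_mul_of_sq_eq hε, isUnit_iff_ne_zero, mul_ne_zero_iff]
    simp [value, sub_eq_add_neg]
  simp only [hunit] at hs ⊢
  let φ₀ : F →ₐ[K] Ω := Classical.arbitrary _
  exact exists_apply_sum_smul_ne_zero (hs φ₀).1 (hs φ₀).2

end Embeddings

theorem exists_finiteDimensional_factorsThrough {A : Type*} [Monoid A]
    [MulDistribMulAction Gal(Ω/K) A] {u : Gal(Ω/K) → A} (hlc : IsLocallyConstant u)
    (hunit : ∀ g, IsUnit (u g)) (hu : ∀ g h, u (g * h) = u g * g • u h) :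
    ∃ F : IntermediateField K Ω, FiniteDimensional K F ∧
      u.FactorsThrough fun g => (g : Ω →ₐ[K] Ω).comp F.val := by
  have hu1 : u 1 = 1 := by
    have h := hu 1 1
    rwa [mul_one, one_smul, eq_comm, (hunit 1).mul_eq_left] at h
  obtain ⟨F, hF, hFu⟩ := (krullTopology_mem_nhds_one_iff _ _ _).1
    ((hlc.isOpen_fiber 1).mem_nhds hu1)
  refine ⟨F, hF, fun g h hgh => ?_⟩
  have hmem : g⁻¹ * h ∈ F.fixingSubgroup := by
    rw [IntermediateField.mem_fixingSubgroup_iff]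
    intro x hx
    have hx' : g x = h x := DFunLike.congr_fun hgh ⟨x, hx⟩
    rw [AlgEquiv.mul_apply, ← hx']
    exact g.symm_apply_apply x
  have hone : u (g⁻¹ * h) = 1 := hFu hmem
  rw [← mul_inv_cancel_left g h, hu, hone, smul_one, mul_one]

variable [IsGalois K Ω]

theorem exists_comp_val_eq {F : IntermediateField K Ω} (φ : F →ₐ[K] Ω) :
    ∃ g : Gal(Ω/K), (g : Ω →ₐ[K] Ω).comp F.val = φ :=
  ⟨(Algebra.IsAlgebraic.algEquivEquivAlgHom K Ω).symm (φ.liftNormal Ω),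
    AlgHom.ext fun x => φ.liftNormal_commutes Ω x⟩

theorem exists_isUnit_forall_mul_smul_eq {d : K} {ε : Ω} (hε : ε ^ 2 = algebraMap K Ω d)
    {u : Gal(Ω/K) → ExtSqrtAlg Ω d} (hlc : IsLocallyConstant u) (hunit : ∀ g, IsUnit (u g))
    (hu : ∀ g h, u (g * h) = u g * g • u h) :
    ∃ β, IsUnit β ∧ ∀ g, u g * g • β = β := by
  obtain ⟨F, _, hF⟩ := exists_finiteDimensional_factorsThrough hlc hunit hu
  let s := Function.extend (fun g : Gal(Ω/K) => (g : Ω →ₐ[K] Ω).comp F.val) u 0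
  have hs (g : Gal(Ω/K)) : s ((g : Ω →ₐ[K] Ω).comp F.val) = u g := hF.extend_apply 0 g
  have : Nonempty (F →ₐ[K] Ω) := ⟨F.val⟩
  obtain ⟨x, hx⟩ := exists_isUnit_sum_smul hε (s := s) fun φ => by
    obtain ⟨g, rfl⟩ := exists_comp_val_eq φ
    exact hs g ▸ hunit g
  -- The sum over the embeddings is fixed by the twisted action, as `u` descends to the cocycle `s`.
  refine ⟨_, hx, fun g => ?_⟩
  rw [Finset.smul_sum, Finset.mul_sum]
  refine Fintype.sum_equiv (AlgEquiv.refl.arrowCongr g) _ _ fun φ => ?_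
  obtain ⟨h, rfl⟩ := exists_comp_val_eq φ
  have hgh : AlgEquiv.refl.arrowCongr g ((h : Ω →ₐ[K] Ω).comp F.val) =
      ((g * h : Gal(Ω/K)) : Ω →ₐ[K] Ω).comp F.val := rfl
  have hsmul (y : Ω) (z : ExtSqrtAlg Ω d) : g • y • z = g y • g • z := by ext <;> simp
  rw [hgh, hs, hs, hu, hsmul, mul_smul_comm]
  rfl

end Hilbert90

/-! ### Kummer theory -/

section LocallyConstant

variable {K Ω : Type*} [Field K] [Field Ω] [Algebra K Ω]

theorem isLocallyConstant_galois_apply [Algebra.IsIntegral K Ω] (x : Ω) :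
    IsLocallyConstant fun g : Gal(Ω/K) => g x := by
  refine (IsLocallyConstant.iff_exists_open _).2 fun g => ?_
  refine ⟨_, (stabilizer_isOpen_of_isIntegral x).leftCoset g, ⟨1, one_mem _, mul_one g⟩, ?_⟩
  rintro _ ⟨h, hh : h x = x, rfl⟩
  exact congrArg g hh

theorem ExtSqrtAlg.isLocallyConstant_smul [Algebra.IsIntegral K Ω] {d : K} (z : ExtSqrtAlg Ω d) :
    IsLocallyConstant fun g : Gal(Ω/K) => g • z :=
  (isLocallyConstant_galois_apply z.re).comp₂ (isLocallyConstant_galois_apply z.im)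
    QuadraticAlgebra.mk

end LocallyConstant

section KummerRoot

variable {K : Type*} [Field K] {D : K}
  {χ : AddChar (CyclicFour D) (ExtSqrtAlg (SeparableClosure K) (-D))}
  {σ τ : AbsGal K → CyclicFour D} {α α' : SqrtAlg (-D)} {c c' : K}
  {β β' : ExtSqrtAlg (SeparableClosure K) (-D)}

/-- `β` is a preimage of the pair `(α, c)` under `β ↦ (β⁴, N(β))`, and `σ` is the cocycle
`g ↦ g(β)/β` that measures the failure of `β` to be defined over `K`. -/
structure IsKummerRoot (χ : AddChar (CyclicFour D) (ExtSqrtAlg (SeparableClosure K) (-D)))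
    (σ : AbsGal K → CyclicFour D) (α : SqrtAlg (-D)) (c : K)
    (β : ExtSqrtAlg (SeparableClosure K) (-D)) : Prop where
  pow_four_eq : β ^ 4 = ofBase _ α
  norm_eq : norm β = algebraMap K _ c
  smul_eq (g : AbsGal K) : g • β = χ (σ g) * β

namespace IsKummerRoot

theorem mul (h : IsKummerRoot χ σ α c β) (h' : IsKummerRoot χ τ α' c' β') :
    IsKummerRoot χ (σ + τ) (α * α') (c * c') (β * β') where
  pow_four_eq := by rw [mul_pow, h.pow_four_eq, h'.pow_four_eq, map_mul]
  norm_eq := by rw [map_mul, h.norm_eq, h'.norm_eq, map_mul]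
  smul_eq g := by
    rw [smul_mul', h.smul_eq, h'.smul_eq, Pi.add_apply, χ.map_add_eq_mul, mul_mul_mul_comm]

theorem ofBase (z : SqrtAlg (-D)) : IsKummerRoot χ 0 (z ^ 4) (norm z) (ofBase _ z) where
  pow_four_eq := (map_pow _ _ _).symm
  norm_eq := norm_ofBase z
  smul_eq g := by rw [smul_ofBase, Pi.zero_apply, χ.map_zero_eq_one, one_mul]

theorem isUnit (h : IsKummerRoot χ σ α c β) (hc : c ≠ 0) : IsUnit β := by
  rw [isUnit_iff_norm_isUnit, h.norm_eq, isUnit_iff_ne_zero]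
  exact (map_ne_zero _).2 hc

theorem inv (h : IsKummerRoot χ σ α c β) (hα : α * α' = 1) (hc : c * c' = 1)
    (hβ : β * β' = 1) : IsKummerRoot χ (-σ) α' c' β' where
  pow_four_eq := left_inv_eq_right_inv (by rw [← mul_pow, mul_comm, hβ, one_pow])
    (by rw [h.pow_four_eq, ← map_mul, hα, map_one])
  norm_eq := left_inv_eq_right_inv (by rw [← map_mul, mul_comm, hβ, map_one])
    (by rw [h.norm_eq, ← map_mul, hc, map_one])
  smul_eq g := by
    refine left_inv_eq_right_inv (by rw [← smul_mul', mul_comm, hβ, smul_one]) ?_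
    rw [h.smul_eq, mul_mul_mul_comm, ← χ.map_add_eq_mul, hβ, Pi.neg_apply, add_neg_cancel,
      χ.map_zero_eq_one, one_mul]

theorem exists_eq_of_zero (h : IsKummerRoot χ 0 α c β) : ∃ z, α = z ^ 4 ∧ c = norm z := by
  obtain ⟨z, rfl⟩ := mem_range_ofBase.2 fun g => by
    rw [h.smul_eq, Pi.zero_apply, χ.map_zero_eq_one, one_mul]
  exact ⟨z, ofBase_injective (by rw [← h.pow_four_eq, map_pow]),
    (algebraMap K (SeparableClosure K)).injective (by rw [← h.norm_eq, norm_ofBase])⟩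

end IsKummerRoot

theorem exists_pow_four_eq_and_norm_eq {F : Type*} [Field F] [IsSepClosed F] [NeZero (2 : F)]
    {d ε : F} (hε : ε ^ 2 = d) (hε0 : ε ≠ 0) {α : SqrtAlg d} {c : F} (hc : c ≠ 0)
    (h : norm α = c ^ 4) : ∃ β : SqrtAlg d, β ^ 4 = α ∧ norm β = c := by
  have : NeZero ((4 : ℕ) : F) := ⟨by simpa using four_ne_zero_of_two_ne_zero (F := F)⟩
  obtain ⟨u, hu⟩ := IsSepClosed.exists_pow_nat_eq (α.re + ε * α.im) 4
  rw [norm_eq_mul_of_sq_eq hε, ← hu] at h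
  have hu0 : u ≠ 0 := by
    rintro rfl
    exact hc (by simpa using h.symm)
  have hcu : u * (c / u) = c := mul_div_cancel₀ c hu0
  have hcomp : u ^ 4 = α.re + ε * α.im ∧ (c / u) ^ 4 = α.re - ε * α.im := by
    refine ⟨hu, mul_left_cancel₀ (pow_ne_zero 4 hu0) ?_⟩
    rw [← mul_pow, hcu, h]
  let β := (splitEquiv hε hε0).symm (u, c / u)
  have hβ : splitEquiv hε hε0 β = (u, c / u) := RingEquiv.apply_symm_apply _ _
  refine ⟨β, (splitEquiv hε hε0).injective ?_, ?_⟩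
  · rw [map_pow, hβ]
    exact Prod.ext hcomp.1 hcomp.2
  · rw [norm_eq_mul_of_sq_eq hε, ← hcu]
    exact congrArg (fun p => p.1 * p.2) hβ

namespace IsKummerChar

theorem pow_four_eq_one (χ : AddChar (CyclicFour D) (ExtSqrtAlg (SeparableClosure K) (-D)))
    (x : CyclicFour D) : χ x ^ 4 = 1 := by
  rw [← χ.map_nsmul_eq_pow, CyclicFour.four_nsmul, χ.map_zero_eq_one]

theorem isKummerRoot (hχ : IsKummerChar χ) (x : CyclicFour D) :
    IsKummerRoot χ (fun g => g • x - x) 1 1 (χ x) where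
  pow_four_eq := by rw [pow_four_eq_one, map_one]
  norm_eq := by rw [hχ.norm_apply, map_one]
  smul_eq g := by rw [hχ.smul_apply, ← χ.map_add_eq_mul, sub_add_cancel]

theorem exists_eq_coboundary (hχ : IsKummerChar χ) (h : IsKummerRoot χ σ 1 1 β) :
    ∃ x, ∀ g, σ g = g • x - x := by
  obtain ⟨x, rfl⟩ := hχ.exists_eq (h.pow_four_eq.trans (map_one _)) (h.norm_eq.trans (map_one _))
  refine ⟨x, fun g => eq_sub_of_add_eq (hχ.injective ?_)⟩
  rw [χ.map_add_eq_mul, ← h.smul_eq, hχ.smul_apply]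

theorem mem_Z1_of_smul_eq (hχ : IsKummerChar χ) (hβ : IsUnit β)
    (h : ∀ g, g • β = χ (σ g) * β) : σ ∈ Z1 (AbsGal K) (CyclicFour D) := by
  constructor
  · obtain ⟨γ, hγ⟩ := hβ.exists_right_inv
    have hσ : χ ∘ σ = fun g => g • β * γ := funext fun g => by
      rw [h, mul_assoc, hγ, mul_one, Function.comp_apply]
    exact IsLocallyConstant.desc σ χ (hσ ▸ (isLocallyConstant_smul β).comp (· * γ)) hχ.injective
  · intro g h'
    refine hχ.injective (hβ.mul_right_cancel ?_)
    rw [← h, mul_smul, h, smul_mul', h, hχ.smul_apply, χ.map_add_eq_mul]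
    ring

theorem exists_isKummerRoot_of_norm_eq [NeZero (2 : K)] (hχ : IsKummerChar χ) (hD : D ≠ 0)
    (hc : c ≠ 0) (h : norm α = c ^ 4) :
    ∃ σ ∈ Z1 (AbsGal K) (CyclicFour D), ∃ β, IsKummerRoot χ σ α c β := by
  obtain ⟨ε, hε⟩ := exists_sq_eq_algebraMap (-D)
  have hε0 : ε ≠ 0 := by
    rintro rfl
    exact hD (by simpa using hε.symm)
  have hc' : algebraMap K (SeparableClosure K) c ≠ 0 := (map_ne_zero _).2 hc
  obtain ⟨β, hβ4, hβN⟩ := exists_pow_four_eq_and_norm_eq hε hε0 (α := ofBase _ α) hc'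
    (by rw [norm_ofBase, h, map_pow])
  have hβ : IsUnit β := isUnit_iff_norm_isUnit.2 (hβN ▸ isUnit_iff_ne_zero.2 hc')
  obtain ⟨γ, hγ⟩ := hβ.exists_right_inv
  have hσ (g : AbsGal K) : ∃ x, χ x = g • β * γ := by
    refine hχ.exists_eq ?_ ?_
    · rw [mul_pow, ← smul_pow', hβ4, smul_ofBase, ← hβ4, ← mul_pow, hγ, one_pow]
    · rw [map_mul, ExtSqrtAlg.norm_smul, hβN, AlgEquiv.commutes, ← hβN, ← map_mul, hγ, map_one]
  choose σ hσ using hσ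
  have hsmul (g : AbsGal K) : g • β = χ (σ g) * β := by
    rw [hσ, mul_assoc, mul_comm γ, hγ, mul_one]
  exact ⟨σ, hχ.mem_Z1_of_smul_eq hβ hsmul, β, hβ4, hβN, hsmul⟩

theorem exists_isKummerRoot_of_mem_Z1 [NeZero (2 : K)] (hχ : IsKummerChar χ)
    (hσ : σ ∈ Z1 (AbsGal K) (CyclicFour D)) :
    ∃ (α : SqrtAlg (-D)) (c : K) (β : _), c ≠ 0 ∧ norm α = c ^ 4 ∧ IsKummerRoot χ σ α c β := by
  obtain ⟨ε, hε⟩ := exists_sq_eq_algebraMap (-D)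
  obtain ⟨β, hβ, hfix⟩ := exists_isUnit_forall_mul_smul_eq hε (u := fun g => χ (-σ g))
    (hσ.1.comp fun x => χ (-x)) (fun g => χ.val_isUnit _)
    (fun g h => by rw [hσ.2, neg_add, χ.map_add_eq_mul, hχ.smul_apply, smul_neg])
  have hsmul (g : AbsGal K) : g • β = χ (σ g) * β := by
    have hinv : χ (σ g) * χ (-σ g) = 1 := by
      rw [← χ.map_add_eq_mul, add_neg_cancel, χ.map_zero_eq_one]
    rw [← one_mul (g • β), ← hinv, mul_assoc, hfix]
  obtain ⟨α, hα⟩ := mem_range_ofBase.2 fun g : AbsGal K => show g • β ^ 4 = β ^ 4 by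
    rw [smul_pow', hsmul, mul_pow, pow_four_eq_one, one_mul]
  obtain ⟨c, hc⟩ := (InfiniteGalois.mem_range_algebraMap_iff_fixed (k := K) (norm β)).2 fun g => by
    rw [← ExtSqrtAlg.norm_smul, hsmul, map_mul, hχ.norm_apply, one_mul]
  have hinj := (algebraMap K (SeparableClosure K)).injective
  refine ⟨α, c, β, ?_, hinj ?_, hα.symm, hc.symm, hsmul⟩
  · rw [← map_ne_zero (algebraMap K (SeparableClosure K)), hc]
    exact (isUnit_iff_norm_isUnit.1 hβ).ne_zero
  · rw [← norm_ofBase, hα, map_pow, map_pow, hc]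

end IsKummerChar

end KummerRoot

section KummerIsomorphism

variable {K : Type*} [Field K] {D : K}
  {χ : AddChar (CyclicFour D) (ExtSqrtAlg (SeparableClosure K) (-D))}

theorem norm_eq_of_mem_kummerData (p : kummerData D) :
    norm (p.1.1 : SqrtAlg (-D)) = (p.1.2 : K) ^ 4 := by
  simpa using congrArg Units.val p.2

theorem exists_kummerData_eq {α : SqrtAlg (-D)} {c : K} (hc : c ≠ 0) (h : norm α = c ^ 4) :
    ∃ p : kummerData D, (p.1.1 : SqrtAlg (-D)) = α ∧ (p.1.2 : K) = c := by
  have hα : IsUnit α := isUnit_iff_norm_isUnit.2 (h ▸ (isUnit_iff_ne_zero.2 hc).pow 4)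
  exact ⟨⟨(hα.unit, Units.mk0 c hc), Units.ext (by simpa using h)⟩, rfl, rfl⟩

theorem mk_eq_zero_iff_exists_coboundary (σ : Z1 (AbsGal K) (CyclicFour D)) :
    (QuotientAddGroup.mk σ : H1 (AbsGal K) (CyclicFour D)) = 0 ↔ ∃ x, ∀ g, σ.1 g = g • x - x :=
  QuotientAddGroup.eq_zero_iff σ

theorem mk_eq_one_iff_exists_pow_four (p : kummerData D) :
    (QuotientGroup.mk p : KummerGroup D) = 1 ↔
      ∃ z, (p.1.1 : SqrtAlg (-D)) = z ^ 4 ∧ (p.1.2 : K) = norm z := by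
  rw [QuotientGroup.eq_one_iff, Subgroup.mem_subgroupOf, kummerTrivial, MonoidHom.mem_range]
  constructor
  · rintro ⟨z, hz⟩
    exact ⟨z, by simp [← hz], by simp [← hz]⟩
  · rintro ⟨z, hz, hz'⟩
    have hzu : IsUnit z := isUnit_iff_norm_isUnit.2 (hz' ▸ p.1.2.isUnit)
    exact ⟨hzu.unit, Prod.ext (Units.ext (by simp [hz])) (Units.ext (by simp [hz']))⟩

/-- The correspondence between cocycles and Kummer data: `σ` is related to `(α, c)` when some
preimage `β` of `(α, c)` under `β ↦ (β⁴, N(β))` has `g(β)/β = σ(g)`. -/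
def kummerCorrespondence
    (χ : AddChar (CyclicFour D) (ExtSqrtAlg (SeparableClosure K) (-D))) :
    AddSubgroup (Z1 (AbsGal K) (CyclicFour D) × Additive (kummerData D)) where
  carrier := {w | ∃ β, IsKummerRoot χ w.1 (w.2.toMul.1.1 : SqrtAlg (-D)) (w.2.toMul.1.2 : K) β}
  zero_mem' := ⟨_, by simpa using IsKummerRoot.ofBase (χ := χ) 1⟩
  add_mem' := by
    rintro v w ⟨β, hβ⟩ ⟨γ, hγ⟩
    exact ⟨β * γ, hβ.mul hγ⟩
  neg_mem' := by
    rintro w ⟨β, hβ⟩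
    obtain ⟨γ, hγ⟩ := (hβ.isUnit (Units.ne_zero _)).exists_right_inv
    exact ⟨γ, hβ.inv (Units.mul_inv _) (Units.mul_inv _) hγ⟩

namespace IsKummerRoot

variable {σ : Z1 (AbsGal K) (CyclicFour D)} {p : kummerData D}
  {β : ExtSqrtAlg (SeparableClosure K) (-D)}

theorem exists_of_mk_eq {q : kummerData D}
    (h : IsKummerRoot χ σ (p.1.1 : SqrtAlg (-D)) (p.1.2 : K) β)
    (hpq : (QuotientGroup.mk p : KummerGroup D) = QuotientGroup.mk q) :
    ∃ γ, IsKummerRoot χ σ (q.1.1 : SqrtAlg (-D)) (q.1.2 : K) γ := by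
  obtain ⟨z, hz, hz'⟩ := (mk_eq_one_iff_exists_pow_four (p⁻¹ * q)).1
    (by rw [QuotientGroup.mk_mul, QuotientGroup.mk_inv, hpq, inv_mul_cancel])
  have hγ := h.mul (ofBase z)
  rw [← hz, ← hz', add_zero, ← Units.val_mul, ← Units.val_mul] at hγ
  exact ⟨_, by simpa using hγ⟩

theorem mk_eq_zero_iff (hχ : IsKummerChar χ)
    (h : IsKummerRoot χ σ (p.1.1 : SqrtAlg (-D)) (p.1.2 : K) β) :
    (QuotientAddGroup.mk σ : H1 (AbsGal K) (CyclicFour D)) = 0 ↔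
      (QuotientGroup.mk p : KummerGroup D) = 1 := by
  rw [mk_eq_zero_iff_exists_coboundary]
  constructor
  · rintro ⟨x, hx⟩
    have hσ : (σ : AbsGal K → CyclicFour D) + (fun g => g • (-x) - -x) = 0 := by
      funext g
      simp [hx, smul_neg]
    have h' := h.mul (hχ.isKummerRoot (-x))
    rw [hσ, mul_one, mul_one] at h'
    exact (mk_eq_one_iff_exists_pow_four p).2 h'.exists_eq_of_zero
  · intro hp
    obtain ⟨γ, hγ⟩ := h.exists_of_mk_eq (q := 1) hp
    exact hχ.exists_eq_coboundary (by simpa using hγ)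

end IsKummerRoot

theorem exists_mem_kummerCorrespondence_left [NeZero (2 : K)] (hχ : IsKummerChar χ)
    (σ : Z1 (AbsGal K) (CyclicFour D)) : ∃ p, (σ, p) ∈ kummerCorrespondence χ := by
  obtain ⟨α, c, β, hc, hN, hβ⟩ := hχ.exists_isKummerRoot_of_mem_Z1 σ.2
  obtain ⟨p, rfl, rfl⟩ := exists_kummerData_eq hc hN
  exact ⟨Additive.ofMul p, β, hβ⟩

theorem exists_mem_kummerCorrespondence_right [NeZero (2 : K)] (hχ : IsKummerChar χ) (hD : D ≠ 0)
    (p : Additive (kummerData D)) : ∃ σ, (σ, p) ∈ kummerCorrespondence χ := by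
  obtain ⟨σ, hσ, β, hβ⟩ := hχ.exists_isKummerRoot_of_norm_eq hD (Units.ne_zero _)
    (norm_eq_of_mem_kummerData p.toMul)
  exact ⟨⟨σ, hσ⟩, β, hβ⟩

theorem exists_addEquiv_kummerGroup [NeZero (2 : K)] (hχ : IsKummerChar χ) (hD : D ≠ 0) :
    ∃ Φ : H1 (AbsGal K) (CyclicFour D) ≃+ Additive (KummerGroup D),
      ∀ (σ : Z1 (AbsGal K) (CyclicFour D)) (p : kummerData D),
        Φ (QuotientAddGroup.mk σ) = Additive.ofMul (QuotientGroup.mk p) ↔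
          ∃ β, IsKummerRoot χ σ (p.1.1 : SqrtAlg (-D)) (p.1.2 : K) β := by
  let f : kummerCorrespondence χ →+ H1 (AbsGal K) (CyclicFour D) × Additive (KummerGroup D) :=
    ((QuotientAddGroup.mk' _).prodMap (QuotientGroup.mk' _).toAdditive).comp
      (kummerCorrespondence χ).subtype
  obtain ⟨Φ, hΦ⟩ := AddMonoidHom.exists_addEquiv_range_eq_graph (I := Additive (KummerGroup D))
    (f := f)
    (by
      rintro ⟨σ⟩
      obtain ⟨p, hp⟩ := exists_mem_kummerCorrespondence_left hχ σ
      exact ⟨⟨(σ, p), hp⟩, rfl⟩)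
    (by
      rintro ⟨p⟩
      obtain ⟨σ, hσ⟩ := exists_mem_kummerCorrespondence_right hχ hD p
      exact ⟨⟨(σ, p), hσ⟩, rfl⟩)
    (fun v w => by
      obtain ⟨β, hβ⟩ := (v - w).2
      rw [← sub_eq_zero, ← sub_eq_zero (a := (f v).2), ← Prod.fst_sub, ← Prod.snd_sub]
      exact hβ.mk_eq_zero_iff hχ)
  have hΦf (w : kummerCorrespondence χ) : Φ (f w).1 = (f w).2 :=
    hΦ.le ⟨w, rfl⟩
  refine ⟨Φ, fun σ p => ⟨fun h => ?_, fun ⟨β, hβ⟩ => hΦf ⟨(σ, Additive.ofMul p), β, hβ⟩⟩⟩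
  obtain ⟨q, β, hβ⟩ := exists_mem_kummerCorrespondence_left hχ σ
  exact hβ.exists_of_mk_eq ((hΦf ⟨(σ, q), β, hβ⟩).symm.trans h)

end KummerIsomorphism

/-! ### The quartic algebra -/

theorem formallyUnramified_of_isUnit_discr {R : Type*} [CommRing R] {a b : R}
    (h : IsUnit (b ^ 2 + 4 * a)) : Algebra.FormallyUnramified R (QuadraticAlgebra R a b) := by
  rw [Algebra.FormallyUnramified.iff_comp_injective]
  intro B _ _ I hI f g hfg
  have hroot (k : QuadraticAlgebra R a b →ₐ[R] B) :
      k ω * k ω = algebraMap R B a + algebraMap R B b * k ω := by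
    rw [← map_mul, omega_mul_omega_eq_algebraMap, map_add, map_mul, k.commutes, k.commutes]
  have hmem : f ω - g ω ∈ I := Ideal.Quotient.eq.1 (DFunLike.congr_fun hfg ω)
  have hsq : (f ω - g ω) ^ 2 = 0 := by
    simpa [hI] using Ideal.pow_mem_pow hmem 2
  have hdiscr : (2 * g ω - algebraMap R B b) ^ 2 = algebraMap R B (b ^ 2 + 4 * a) := by
    simp only [map_add, map_mul, map_pow, map_ofNat]
    linear_combination 4 * hroot g
  have hderiv : IsUnit (2 * g ω - algebraMap R B b) :=
    (isUnit_pow_iff two_ne_zero).1 (hdiscr ▸ h.map _)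
  refine algHom_ext (sub_eq_zero.1 (hderiv.mul_right_eq_zero.1 ?_))
  linear_combination hroot f - hroot g - hsq

theorem etale_of_isUnit_discr {R : Type*} [CommRing R] {a b : R} (h : IsUnit (b ^ 2 + 4 * a)) :
    Algebra.Etale R (QuadraticAlgebra R a b) := by
  have := formallyUnramified_of_isUnit_discr h
  have := Module.finitePresentation_of_projective R (QuadraticAlgebra R a b)
  exact .of_formallyUnramified_of_flat

namespace BiquadAlg

variable {K : Type*} [Field K] {d u v : K}

theorem etale [NeZero (2 : K)] (hd : d ≠ 0) (huv : u ^ 2 - d * v ^ 2 ≠ 0) :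
    Algebra.Etale K (BiquadAlg d u v) := by
  have h4 : IsUnit (4 : K) := isUnit_iff_ne_zero.2 four_ne_zero_of_two_ne_zero
  have h4' : IsUnit (4 : SqrtAlg d) := by
    simpa only [map_ofNat] using h4.map (algebraMap K (SqrtAlg d))
  have huv' : IsUnit (⟨u, v⟩ : SqrtAlg d) := by
    rw [isUnit_iff_norm_isUnit, isUnit_iff_ne_zero, norm_def]
    convert huv using 1
    ring
  have : Algebra.Etale K (SqrtAlg d) :=
    etale_of_isUnit_discr (by simpa using ⟨four_ne_zero_of_two_ne_zero, hd⟩)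
  have : Algebra.Etale (SqrtAlg d) (BiquadAlg d u v) :=
    etale_of_isUnit_discr (by simpa using h4'.mul huv')
  exact .comp K (SqrtAlg d) (BiquadAlg d u v)

section AlgHom

variable {A : Type*} [CommRing A] [Algebra K A]

theorem algebraMap_omega : algebraMap (SqrtAlg d) (BiquadAlg d u 1) ω =
    ω ^ 2 - algebraMap K (BiquadAlg d u 1) u := by
  rw [IsScalarTower.algebraMap_apply K (SqrtAlg d) (BiquadAlg d u 1), pow_two,
    omega_mul_omega_eq_mk]
  ext <;> simp

theorem apply_algebraMap (f : BiquadAlg d u 1 →ₐ[K] A) (z : SqrtAlg d) :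
    f (algebraMap (SqrtAlg d) (BiquadAlg d u 1) z) =
      algebraMap K A z.re + algebraMap K A z.im * (f ω ^ 2 - algebraMap K A u) := by
  let φ : SqrtAlg d →ₐ[K] A := f.comp (IsScalarTower.toAlgHom K (SqrtAlg d) (BiquadAlg d u 1))
  have hφ : φ ω = f ω ^ 2 - algebraMap K A u := by
    simp only [φ, AlgHom.comp_apply, IsScalarTower.coe_toAlgHom', algebraMap_omega, map_sub,
      map_pow, f.commutes]
  rw [← hφ, ← Algebra.smul_def, ← φ.commutes, ← map_smul, ← map_add, ← mk_eq_add_smul_omega]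
  rfl

theorem omega_sq_sub_sq (f : BiquadAlg d u 1 →ₐ[K] A) :
    (f ω ^ 2 - algebraMap K A u) ^ 2 = algebraMap K A d := by
  have hω : (ω : SqrtAlg d) ^ 2 = algebraMap K (SqrtAlg d) d := by
    rw [pow_two, omega_mul_omega_eq_mk]
    rfl
  rw [← f.commutes u, ← map_pow, ← map_sub, ← algebraMap_omega, ← map_pow, ← map_pow, hω,
    ← IsScalarTower.algebraMap_apply, f.commutes]

theorem algHom_ext {f g : BiquadAlg d u 1 →ₐ[K] A} (h : f ω = g ω) : f = g := by
  ext z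
  have hz : z = algebraMap (SqrtAlg d) _ z.re + algebraMap (SqrtAlg d) _ z.im * ω := by
    rw [← Algebra.smul_def]
    exact mk_eq_add_smul_omega z.re z.im
  rw [hz]
  simp only [map_add, map_mul, apply_algebraMap, h]

theorem exists_algHom_omega_eq {r : A} (hr : (r ^ 2 - algebraMap K A u) ^ 2 = algebraMap K A d) :
    ∃ f : BiquadAlg d u 1 →ₐ[K] A, f ω = r := by
  let k : SqrtAlg d →ₐ[K] A := lift ⟨r ^ 2 - algebraMap K A u, by
    rw [← pow_two, hr, zero_smul, add_zero, Algebra.algebraMap_eq_smul_one]⟩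
  algebraize [k.toRingHom]
  have : IsScalarTower K (SqrtAlg d) A := .of_algHom k
  have hr' : r * r = (⟨u, 1⟩ : SqrtAlg d) • (1 : A) + (0 : SqrtAlg d) • r := by
    have hk : algebraMap (SqrtAlg d) A ⟨u, 1⟩ = algebraMap K A u + (r ^ 2 - algebraMap K A u) := by
      simp [RingHom.algebraMap_toAlgebra, k, Algebra.algebraMap_eq_smul_one]
    rw [zero_smul, add_zero, ← Algebra.algebraMap_eq_smul_one, hk]
    ring
  exact ⟨(lift ⟨r, hr'⟩).restrictScalars K, by simp⟩

end AlgHom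

end BiquadAlg

theorem trace_sq_eq_trace_sq_add {R : Type*} [CommRing R] {a b : R} (z : QuadraticAlgebra R a b) :
    trace z ^ 2 = trace (z ^ 2) + 2 * norm z := by
  simp only [pow_two, trace_def, norm_def, re_mul, im_mul]
  ring

namespace CyclicFour

variable {K : Type*} [Field K] {D : K}

theorem two_nsmul_eq_zero_or_eq {m : CyclicFour D} (hm : m ≠ 0) (hm2 : 2 • m = 0)
    (x : CyclicFour D) : 2 • x = 0 ∨ 2 • x = m := by
  have h4 : 2 • 2 • x = 2 • (0 : CyclicFour D) := by
    rw [← mul_nsmul, four_nsmul, smul_zero]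
  simpa using (nsmul_two_eq_iff hm hm2).1 h4

theorem exists_two_nsmul_eq {m : CyclicFour D} (hm : m ≠ 0) (hm2 : 2 • m = 0) :
    ∃ x : CyclicFour D, 2 • x = m := by
  have h : ∀ m : ZMod 4, m ≠ 0 → 2 • m = 0 → ∃ x : ZMod 4, 2 • x = m := by decide
  exact h m hm hm2

end CyclicFour

section KummerTrace

variable {K : Type*} [Field K] {D : K}
  {χ : AddChar (CyclicFour D) (ExtSqrtAlg (SeparableClosure K) (-D))}
  {σ : AbsGal K → CyclicFour D} {α : SqrtAlg (-D)} {c : K}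
  {β : ExtSqrtAlg (SeparableClosure K) (-D)} {m : CyclicFour D}

/-- The roots of the quartic attached to `β`: the traces from `K^sep[√(-D)]` to `K^sep` of the
translates of `β` by the kernel of `β ↦ (β⁴, N(β))`, labelled by `M`. -/
noncomputable def kummerTrace (χ : AddChar (CyclicFour D) (ExtSqrtAlg (SeparableClosure K) (-D)))
    (β : ExtSqrtAlg (SeparableClosure K) (-D)) (x : CyclicFour D) : SeparableClosure K :=
  trace (χ x * β)

namespace IsKummerChar

theorem exists_apply_eq_neg_one [NeZero (2 : K)] (hχ : IsKummerChar χ) :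
    ∃ m : CyclicFour D, m ≠ 0 ∧ 2 • m = 0 ∧ χ m = -1 := by
  obtain ⟨m, hm⟩ := hχ.exists_eq (z := -1) (by norm_num) (by simp [norm_def])
  refine ⟨m, ?_, hχ.injective ?_, hm⟩
  · rintro rfl
    have hre : (1 : SeparableClosure K) = -1 := congrArg re (χ.map_zero_eq_one.symm.trans hm)
    exact two_ne_zero (α := SeparableClosure K) (by linear_combination hre)
  · rw [χ.map_nsmul_eq_pow, hm, neg_one_sq, χ.map_zero_eq_one]

end IsKummerChar

theorem kummerTrace_add (hm : χ m = -1) (x : CyclicFour D) :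
    kummerTrace χ β (x + m) = -kummerTrace χ β x := by
  simp [kummerTrace, χ.map_add_eq_mul, hm]

namespace IsKummerRoot

theorem map_kummerTrace (hχ : IsKummerChar χ) (h : IsKummerRoot χ σ α c β) (g : AbsGal K)
    (x : CyclicFour D) : g (kummerTrace χ β x) = kummerTrace χ β (g • x + σ g) := by
  rw [kummerTrace, ← trace_smul, smul_mul', hχ.smul_apply, h.smul_eq, ← mul_assoc,
    ← χ.map_add_eq_mul, kummerTrace]

theorem kummerTrace_sq_sub (hχ : IsKummerChar χ) (h : IsKummerRoot χ σ α c β)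
    (x : CyclicFour D) :
    kummerTrace χ β x ^ 2 - algebraMap K _ (2 * c) = trace (χ (2 • x) * β ^ 2) := by
  rw [kummerTrace, trace_sq_eq_trace_sq_add, map_mul QuadraticAlgebra.norm, hχ.norm_apply,
    h.norm_eq, mul_pow, χ.map_nsmul_eq_pow, map_mul (algebraMap K _), map_ofNat]
  ring

theorem trace_sq_sq (h : IsKummerRoot χ σ α c β) :
    trace (β ^ 2) ^ 2 = algebraMap K _ (2 * α.re + 2 * c ^ 2) := by
  rw [trace_sq_eq_trace_sq_add, ← pow_mul, h.pow_four_eq, trace_ofBase, map_pow, h.norm_eq,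
    trace_def, zero_mul, add_zero]
  simp only [map_add, map_mul, map_pow, map_ofNat]

theorem norm_eq_pow_four (h : IsKummerRoot χ σ α c β) : norm α = c ^ 4 := by
  apply (algebraMap K (SeparableClosure K)).injective
  rw [← norm_ofBase, ← h.pow_four_eq, map_pow, h.norm_eq, map_pow]

variable [NeZero (2 : K)]

theorem exists_kummerTrace_sq_sub_eq_iff (hχ : IsKummerChar χ) (h : IsKummerRoot χ σ α c β)
    {t : SeparableClosure K} :
    (∃ x, kummerTrace χ β x ^ 2 - algebraMap K _ (2 * c) = t) ↔
      t ^ 2 = algebraMap K _ (2 * α.re + 2 * c ^ 2) := by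
  obtain ⟨m, hm0, hm2, hm⟩ := hχ.exists_apply_eq_neg_one
  rw [← h.trace_sq_sq, sq_eq_sq_iff_eq_or_eq_neg]
  constructor
  · rintro ⟨x, rfl⟩
    rw [h.kummerTrace_sq_sub hχ]
    rcases CyclicFour.two_nsmul_eq_zero_or_eq hm0 hm2 x with hx | hx
    · exact .inl (by rw [hx, χ.map_zero_eq_one, one_mul])
    · exact .inr (by rw [hx, hm, neg_one_mul, map_neg])
  · rintro (rfl | rfl)
    · exact ⟨0, by rw [h.kummerTrace_sq_sub hχ, smul_zero, χ.map_zero_eq_one, one_mul]⟩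
    · obtain ⟨y, hy⟩ := CyclicFour.exists_two_nsmul_eq hm0 hm2
      exact ⟨y, by rw [h.kummerTrace_sq_sub hχ, hy, hm, neg_one_mul, map_neg]⟩

theorem kummerTrace_sq_sub_sq (hχ : IsKummerChar χ) (h : IsKummerRoot χ σ α c β)
    (x : CyclicFour D) : (kummerTrace χ β x ^ 2 - algebraMap K _ (2 * c)) ^ 2 =
      algebraMap K _ (2 * α.re + 2 * c ^ 2) :=
  (h.exists_kummerTrace_sq_sub_eq_iff hχ).1 ⟨x, rfl⟩

theorem kummerTrace_sq_eq_sq_iff (hχ : IsKummerChar χ) (h : IsKummerRoot χ σ α c β)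
    (hd : 2 * α.re + 2 * c ^ 2 ≠ 0) {x y : CyclicFour D} :
    kummerTrace χ β x ^ 2 = kummerTrace χ β y ^ 2 ↔ 2 • x = 2 • y := by
  obtain ⟨m, hm0, hm2, hm⟩ := hχ.exists_apply_eq_neg_one
  rw [← sub_left_inj (a := algebraMap K (SeparableClosure K) (2 * c)), h.kummerTrace_sq_sub hχ,
    h.kummerTrace_sq_sub hχ]
  refine ⟨fun hxy => ?_, fun hxy => by rw [hxy]⟩
  have h4 : 2 • 2 • x = 2 • 2 • y := by
    rw [← mul_nsmul, ← mul_nsmul, CyclicFour.four_nsmul, CyclicFour.four_nsmul]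
  refine ((CyclicFour.nsmul_two_eq_iff hm0 hm2).1 h4).resolve_right fun hne => ?_
  rw [hne, χ.map_add_eq_mul, hm, mul_neg_one, neg_mul, map_neg] at hxy
  have hzero : trace (χ (2 • y) * β ^ 2) = 0 :=
    mul_left_cancel₀ (two_ne_zero (α := SeparableClosure K)) (by linear_combination -hxy)
  have hsq := h.kummerTrace_sq_sub_sq hχ y
  rw [h.kummerTrace_sq_sub hχ, hzero, zero_pow two_ne_zero, eq_comm, map_eq_zero] at hsq
  exact hd hsq

theorem kummerTrace_injective (hχ : IsKummerChar χ) (h : IsKummerRoot χ σ α c β)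
    (hd : 2 * α.re + 2 * c ^ 2 ≠ 0) (hu : (2 * c) ^ 2 ≠ 2 * α.re + 2 * c ^ 2) :
    Function.Injective (kummerTrace χ β) := by
  obtain ⟨m, hm0, hm2, hm⟩ := hχ.exists_apply_eq_neg_one
  intro x y hxy
  have h2 := (h.kummerTrace_sq_eq_sq_iff hχ hd).1 (congrArg (· ^ 2) hxy)
  refine ((CyclicFour.nsmul_two_eq_iff hm0 hm2).1 h2).resolve_right fun hne => ?_
  rw [hne, kummerTrace_add hm] at hxy
  have hzero : kummerTrace χ β y = 0 :=
    mul_left_cancel₀ (two_ne_zero (α := SeparableClosure K)) (by linear_combination -hxy)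
  have hsq := h.kummerTrace_sq_sub_sq hχ y
  rw [hzero, zero_pow two_ne_zero, zero_sub, neg_sq, ← map_pow] at hsq
  exact hu ((algebraMap K (SeparableClosure K)).injective hsq)

theorem mem_range_kummerTrace_iff (hχ : IsKummerChar χ) (h : IsKummerRoot χ σ α c β)
    {r : SeparableClosure K} : r ∈ Set.range (kummerTrace χ β) ↔
      (r ^ 2 - algebraMap K _ (2 * c)) ^ 2 = algebraMap K _ (2 * α.re + 2 * c ^ 2) := by
  obtain ⟨m, -, -, hm⟩ := hχ.exists_apply_eq_neg_one
  rw [← h.exists_kummerTrace_sq_sub_eq_iff hχ]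
  constructor
  · rintro ⟨x, rfl⟩
    exact ⟨x, rfl⟩
  · rintro ⟨x, hx⟩
    rcases sq_eq_sq_iff_eq_or_eq_neg.1 (sub_left_inj.1 hx) with hr | hr
    · exact ⟨x, hr⟩
    · exact ⟨x + m, by rw [kummerTrace_add hm, hr, neg_neg]⟩

theorem exists_equiv_coord (hχ : IsKummerChar χ) (h : IsKummerRoot χ σ α c β)
    (hd : 2 * α.re + 2 * c ^ 2 ≠ 0) (hu : (2 * c) ^ 2 ≠ 2 * α.re + 2 * c ^ 2) :
    ∃ ι : CyclicFour D ≃ Coord K (BiquadAlg (2 * α.re + 2 * c ^ 2) (2 * c) 1),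
      ∀ x, ι x ω = kummerTrace χ β x := by
  choose ι hι using fun x => BiquadAlg.exists_algHom_omega_eq (h.kummerTrace_sq_sub_sq hχ x)
  refine ⟨Equiv.ofBijective ι ⟨fun x y hxy => ?_, fun f => ?_⟩, hι⟩
  · exact h.kummerTrace_injective hχ hd hu (by rw [← hι, hxy, hι])
  · obtain ⟨x, hx⟩ := (h.mem_range_kummerTrace_iff hχ).2 (BiquadAlg.omega_sq_sub_sq f)
    exact ⟨x, BiquadAlg.algHom_ext (by rw [hι, hx])⟩

theorem correspondsTo_of_ne_zero (hχ : IsKummerChar χ) (h : IsKummerRoot χ σ α c β)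
    (hd : 2 * α.re + 2 * c ^ 2 ≠ 0) (hu : (2 * c) ^ 2 ≠ 2 * α.re + 2 * c ^ 2) :
    CorrespondsTo D σ (2 * α.re + 2 * c ^ 2) (2 * c) 1 := by
  obtain ⟨ι, hι⟩ := h.exists_equiv_coord hχ hd hu
  refine ⟨BiquadAlg.etale hd (by simpa [sub_eq_zero] using hu), ι, fun g x z => ?_, fun x y => ?_⟩
  · have hg : (g : SeparableClosure K →ₐ[K] SeparableClosure K).comp (ι x) = ι (g • x + σ g) :=
      BiquadAlg.algHom_ext ((congrArg g (hι x)).trans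
        ((h.map_kummerTrace hχ g x).trans (hι _).symm))
    exact DFunLike.congr_fun hg z
  · simp only [BiquadAlg.apply_algebraMap, hι]
    rw [← h.kummerTrace_sq_eq_sq_iff hχ hd]
    exact ⟨fun hxy z => by rw [hxy], fun hxy => by simpa using hxy ω⟩

theorem correspondsTo (hχ : IsKummerChar χ) (hD : D ≠ 0) (h : IsKummerRoot χ σ α c β)
    (hα : α.im ≠ 0) : CorrespondsTo D σ (2 * α.re + 2 * c ^ 2) (2 * c) 1 := by
  have hN : (c ^ 2 + α.re) * (c ^ 2 - α.re) = D * α.im ^ 2 := by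
    have hnorm := h.norm_eq_pow_four
    rw [norm_def] at hnorm
    linear_combination -hnorm
  obtain ⟨hplus, hminus⟩ := mul_ne_zero_iff.1 (hN ▸ mul_ne_zero hD (pow_ne_zero 2 hα))
  have h2 : (2 : K) ≠ 0 := two_ne_zero
  refine h.correspondsTo_of_ne_zero hχ (fun h0 => hplus ?_) (fun h0 => hminus ?_)
  · exact mul_left_cancel₀ h2 (by linear_combination h0)
  · exact mul_left_cancel₀ h2 (by linear_combination h0)

end IsKummerRoot

end KummerTrace

/-! ### Representatives with `b ≠ 0` -/

theorem exists_ne_zero_and_sq_ne {R : Type*} [CommRing R] [IsDomain R] (a b : R)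
    (hR : 5 < ENat.card R) : ∃ x : R, x ≠ 0 ∧ x ^ 2 ≠ a ∧ x ^ 2 ≠ b := by
  open Polynomial in
  let f : R[X] := X * ((X ^ 2 - C a) * (X ^ 2 - C b))
  have hmonic : f.Monic :=
    monic_X.mul ((monic_X_pow_sub_C a two_ne_zero).mul (monic_X_pow_sub_C b two_ne_zero))
  have hdeg : f.natDegree ≤ 5 := by
    unfold f
    compute_degree
  have hcard : (f.natDegree : Cardinal) < Cardinal.mk R :=
    Cardinal.natCast_lt_toENat.1 ((Nat.cast_le.2 hdeg).trans_lt hR)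
  obtain ⟨x, hx⟩ := exists_eval_ne_zero_of_natDegree_lt_card f hmonic.ne_zero hcard
  refine ⟨x, ?_⟩
  simpa [f, sub_eq_zero] using hx

theorem im_pow_four_of_im_eq_one {R : Type*} [CommRing R] (D x : R) :
    ((⟨x, 1⟩ : SqrtAlg (-D)) ^ 4).im = 4 * x * (x ^ 2 - D) := by
  rw [show 4 = 2 * 2 from rfl, pow_mul, pow_two, pow_two]
  simp only [im_mul, re_mul]
  ring

theorem exists_mk_eq_and_im_ne_zero {K : Type*} [Field K] {D : K} [NeZero (2 : K)]
    (hK : 5 < ENat.card K) (q : KummerGroup D) :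
    ∃ p : kummerData D, QuotientGroup.mk p = q ∧ (p.1.1 : SqrtAlg (-D)).im ≠ 0 := by
  obtain ⟨p, rfl⟩ := QuotientGroup.mk_surjective q
  rcases ne_or_eq (p.1.1 : SqrtAlg (-D)).im 0 with him | him
  · exact ⟨p, rfl, him⟩
  have hre : (p.1.1 : SqrtAlg (-D)).re ≠ 0 := fun h => p.1.1.ne_zero (QuadraticAlgebra.ext h him)
  obtain ⟨x, hx0, hx, hx'⟩ := exists_ne_zero_and_sq_ne D (-D) hK
  have hN : norm (⟨x, 1⟩ : SqrtAlg (-D)) ≠ 0 := fun h =>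
    hx' (by rw [norm_def] at h; linear_combination h)
  obtain ⟨r, hr, hr'⟩ := exists_kummerData_eq hN (map_pow QuadraticAlgebra.norm ⟨x, 1⟩ 4)
  refine ⟨p * r, ?_, ?_⟩
  · exact QuotientGroup.mk_mul_of_mem p
      ((QuotientGroup.eq_one_iff r).1 ((mk_eq_one_iff_exists_pow_four r).2 ⟨_, hr, hr'⟩))
  · have him' : ((p * r).1.1 : SqrtAlg (-D)).im =
        (p.1.1 : SqrtAlg (-D)).re * (4 * x * (x ^ 2 - D)) := by
      rw [← im_pow_four_of_im_eq_one, ← hr]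
      simp [him]
    rw [him']
    exact mul_ne_zero hre (mul_ne_zero (mul_ne_zero four_ne_zero_of_two_ne_zero hx0)
      (sub_ne_zero.2 hx))

theorem mainTheorem3 {K : Type*} [Field K] (hK : ringChar K ≠ 2) (D : K) (hD : D ≠ 0) :
    (∃ Φ : H1 (AbsGal K) (CyclicFour D) ≃+ Additive (KummerGroup D),
      ∀ (σ : Z1 (AbsGal K) (CyclicFour D)) (p : kummerData D) (a b c : K),
        (p.1.1 : SqrtAlg (-D)) = ⟨a, b⟩ → (p.1.2 : K) = c → b ≠ 0 →
        Φ (QuotientAddGroup.mk σ) = Additive.ofMul (QuotientGroup.mk p) →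
        CorrespondsTo D σ (2 * a + 2 * c ^ 2) (2 * c) 1) ∧
    (5 < ENat.card K → ∀ q : KummerGroup D, ∃ p : kummerData D,
      QuotientGroup.mk p = q ∧ (p.1.1 : SqrtAlg (-D)).im ≠ 0) := by
  have : NeZero (2 : K) := ⟨Ring.two_ne_zero hK⟩
  obtain ⟨χ, hχ⟩ := exists_isKummerChar hD
  obtain ⟨Φ, hΦ⟩ := exists_addEquiv_kummerGroup hχ hD
  refine ⟨⟨Φ, fun σ p a b c hα hc hb h => ?_⟩, exists_mk_eq_and_im_ne_zero⟩
  obtain ⟨β, hβ⟩ := (hΦ σ p).1 h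
  rw [hα, hc] at hβ
  exact hβ.correspondsTo hχ hD hb
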